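/- Call a map $f:\mathcal X\to\mathbb R^m$ *almost surjective* if $\mathbb R^m\setminus f(\mathcal X)$ is a Lebesgue null set. (1) Let $n,d\in\mathbb N$. For $K,Q,V\in\mathbb R^{d\times d}$ let the Retention layer $\mathrm{Ret}_{K,Q,V}:(\mathbb R^d)^n\to(\mathbb R^d)^n$ be given by $$\mathrm{Ret}_{K,Q,V}(a)_i=\sum_{j=1}^{i}\bigl(a_j^\top K^\top Q\,a_i\bigr)\,V a_j ,\qquad i=1,\dots,n .$$ Then for all $(K,Q,V)\in(\mathbb R^{d\times d})^3$ outside a Lebesgue null set, $\mathrm{Ret}_{K,Q,V}$ is almost surjective, that is, almost every output sequence $b\in(\mathbb R^d)^n$ is $\mathrm{Ret}_{K,Q,V}(a)$ for some input sequence $a$. (2) Let $1\le r_M\le d$ and $1\le r_N\le d$ be integers, and let $\Theta$ be the set of pairs $(M,N)$ of real $d\times d$ matrices with $\operatorname{rank}M=r_M$ and $\operatorname{rank}N=r_N$, a submanifold of $\mathbb R^{d\times d}\times\mathbb R^{d\times d}$ of dimension $k=r_M(2d-r_M)+r_N(2d-r_N)$, with its $k$-dimensional Hausdorff (surface) measure.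 Then for all $(M,N)\in\Theta$ outside a set of measure zero, the map $$f:\mathbb R^d\to\mathbb R^d,\qquad f(x)=Mx+(x^\top N x)\,x$$ is almost surjective. -/

import Mathlib

open MeasureTheory
open scoped Matrix

namespace Retention

/-- A map into a space with its Lebesgue measure is almost surjective if all points of the
codomain outside a set of measure zero have a preimage. -/
def AlmostSurjective {X Y : Type*} [MeasureSpace Y] (f : X → Y) : Prop :=
  ∀ᵐ y : Y, ∃ x : X, f x = y

/-- A class of maps parameterized by a space `Θ` with a measure is almost always surjective if
its members are almost surjective, except for parameters in a set of measure zero. -/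
def AlmostAlwaysSurjective {Θ X Y : Type*} [MeasurableSpace Θ] [MeasureSpace Y]
    (μ : Measure Θ) (f : Θ → X → Y) : Prop :=
  ∀ᵐ θ ∂μ, AlmostSurjective (f θ)

/-- The entries of a real `d × d` matrix, as a point of the space `ℝ^(d × d)` (which carries
Lebesgue measure and the maximum metric). The matrix itself is `Matrix.of p`. -/
abbrev Entries (d : ℕ) : Type := Fin d → Fin d → ℝ

/-- The Retention layer on sequences of `n` tokens in `ℝ^d`:
`b_i = ∑_{j ≤ i} (a_jᵀ Kᵀ Q a_i) V a_j`. -/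
def ret {n d : ℕ} (K Q V : Matrix (Fin d) (Fin d) ℝ) (a : Fin n → Fin d → ℝ) :
    Fin n → Fin d → ℝ :=
  fun i => ∑ j ∈ Finset.Iic i, (a j ⬝ᵥ ((Kᵀ * Q) *ᵥ a i)) • (V *ᵥ a j)

/-- The single-token map `x ↦ M x + (xᵀ N x) x` on `ℝ^d`. -/
def tokenMap {d : ℕ} (M N : Matrix (Fin d) (Fin d) ℝ) (x : Fin d → ℝ) : Fin d → ℝ :=
  M *ᵥ x + (x ⬝ᵥ (N *ᵥ x)) • x

/-- The pairs of real `d × d` matrices of ranks `rM` and `rN`, a smooth submanifold of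
`ℝ^(d × d) × ℝ^(d × d)` of dimension `rM (2 d - rM) + rN (2 d - rN)`. -/
def FixedRankPairs (d rM rN : ℕ) : Set (Entries d × Entries d) :=
  {p | (Matrix.of p.1).rank = rM ∧ (Matrix.of p.2).rank = rN}

/-- The surface measure on the manifold of pairs of matrices of ranks `rM` and `rN`: Hausdorff
measure in the dimension of that manifold. Its null sets are those of the Riemannian volume (they
do not depend on the norm that is chosen on matrices), that is, the sets that are Lebesgue null
in every smooth chart. -/
noncomputable def fixedRankMeasure (d rM rN : ℕ) : Measure (FixedRankPairs d rM rN) :=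
  μH[(rM : ℝ) * (2 * d - rM) + (rN : ℝ) * (2 * d - rN)]

end Retention

namespace Retention

open Filter Topology Set
open scoped ContDiff

/-! ### Measure theory -/

/-! The equation `tokenMap M N x = b` says that `(M + l) x = b` with `l = xᵀ N x`. Let `p` be the
minimal polynomial of `-M`. Where `p l ≠ 0`, the linear equation is solved by `x = y / p l`, with `y
= B l b` polynomial in `l`, so a zero of `g l = l (p l)² - yᵀ N y` with `p l ≠ 0` is wanted. Since
`x` stays bounded for large `|l|`, `g` changes sign and has a zero, which cannot be a root of `p` if
`yᵀ N y ≠ 0` at the real roots. Almost every `b` satisfies this as soon as the form of `N` does not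
vanish identically on the range of `B l` for any real root `l` (`almostSurjective_tokenMap`).

For matrices of fixed rank, `B l ≠ 0` at a root because `p` is minimal, so for each fixed `M` the
criterion holds for almost all `N` in a chart; Fubini and a finite cover by charts finish.

For Retention, an invertible `V` can be dropped, and one inducts on the tokens: given its
predecessors, the last token solves a single-token equation with `N = A = KᵀQ` and `M = ∑ a_j a_jᵀ
A`. Here `M` depends on `N`, so the criterion is checked directly: by
`quadratic_ne_zero_of_eigenvector` at non-zero roots, and by non-degenerate Gram matrices at the
root `0`. -/

instance isAddHaarMeasure_volume_pi_pi {ι κ : Type*} [Fintype ι] [Fintype κ] :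
    (volume : Measure (ι → κ → ℝ)).IsAddHaarMeasure :=
  Measure.pi.isAddHaarMeasure _

/-- The zero set of a real analytic function that does not vanish identically is null. -/
theorem ae_ne_zero_of_contDiff_omega {E : Type*} [NormedAddCommGroup E] [NormedSpace ℝ E]
    [FiniteDimensional ℝ E] [MeasurableSpace E] [BorelSpace E] (μ : Measure E)
    [μ.IsAddHaarMeasure] {q : E → ℝ} (hq : ContDiff ℝ ω q) {x₀ : E} (h₀ : q x₀ ≠ 0) :
    ∀ᵐ x ∂μ, q x ≠ 0 := by
  let F : E × ℝ → ℝ := fun p => q (x₀ + p.2 • (p.1 - x₀))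
  have hFc : Continuous F := by
    have := hq.continuous
    fun_prop
  -- On every line through `x₀` the function is analytic in one variable and non-zero at `t = 0`, so
  -- its zeros are discrete.
  have hline (x : E) : ∀ᵐ t : ℝ, F (x, t) ≠ 0 := by
    have hcd : ContDiff ℝ ω (fun t : ℝ => F (x, t)) := by
      refine hq.comp ?_
      fun_prop
    have han : AnalyticOnNhd ℝ (fun t : ℝ => F (x, t)) univ :=
      contDiff_omega_iff_analyticOnNhd.1 hcd
    have hmem := han.preimage_zero_mem_codiscrete (x := 0) (by simpa [F] using h₀)
    have hle := ae_restrict_le_codiscreteWithin (μ := (volume : Measure ℝ)) MeasurableSet.univ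
    rw [Measure.restrict_univ] at hle
    filter_upwards [hle hmem] with t ht
    simpa using ht
  have hms : MeasurableSet {p : E × ℝ | ¬ F p ≠ 0} := by
    have : IsClosed {p : E × ℝ | F p = 0} := isClosed_eq hFc continuous_const
    simpa using this.measurableSet
  have hprod : ∀ᵐ p ∂(μ.prod (volume : Measure ℝ)), F p ≠ 0 := by
    rw [ae_iff, Measure.measure_prod_null hms]
    exact Eventually.of_forall fun x => hline x
  have hswap : ∀ᵐ t : ℝ, ∀ᵐ x ∂μ, F (x, t) ≠ 0 := by
    have h1 : ∀ᵐ p ∂((volume : Measure ℝ).prod μ), F p.swap ≠ 0 := by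
      rw [← Measure.prod_swap] at hprod
      exact ae_of_ae_map measurable_swap.aemeasurable hprod
    exact Measure.ae_ae_of_ae_prod h1
  -- A single ratio `t ≠ 0` suffices: the homothety with centre `x₀` and ratio `t` carries the null
  -- zero set of `F (·, t)` onto that of `q`.
  obtain ⟨t, ht, ht0⟩ := (hswap.and (Measure.ae_ne volume (0 : ℝ))).exists
  rw [ae_iff] at ht ⊢
  have hsub : {x | ¬ q x ≠ 0} ⊆
      (fun x => x₀ + t • (x - x₀)) '' {x | ¬ F (x, t) ≠ 0} := by
    intro x hx
    have hxx : x₀ + t • (x₀ + t⁻¹ • (x - x₀) - x₀) = x := by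
      rw [add_sub_cancel_left, smul_smul, mul_inv_cancel₀ ht0, one_smul, add_sub_cancel]
    refine ⟨x₀ + t⁻¹ • (x - x₀), ?_, hxx⟩
    simpa [F, ht0] using hx
  refine measure_mono_null hsub
    (addHaar_image_eq_zero_of_differentiableOn_of_addHaar_eq_zero μ ?_ ht)
  fun_prop

/-- The pairs of a parameter and a value of the corresponding map of a continuous family form a
measurable set. -/
theorem measurableSet_image_graph {Θ X Y : Type*} [TopologicalSpace Θ] [TopologicalSpace X]
    [TopologicalSpace Y] [SigmaCompactSpace Θ] [SigmaCompactSpace X] [T2Space Θ] [T2Space Y]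
    [MeasurableSpace (Θ × Y)] [OpensMeasurableSpace (Θ × Y)] {f : Θ → X → Y} (hf : Continuous fun p : Θ × X => f p.1 p.2) :
    MeasurableSet {p : Θ × Y | ∃ x, f p.1 x = p.2} := by
  have hc : Continuous fun p : Θ × X => (p.1, f p.1 p.2) := by fun_prop
  have heq : {p : Θ × Y | ∃ x, f p.1 x = p.2} = range fun p : Θ × X => (p.1, f p.1 p.2) := by
    ext ⟨θ, y⟩
    simp
  obtain ⟨K, hK, hKu⟩ := isSigmaCompact_range hc
  rw [heq, ← hKu]
  exact MeasurableSet.iUnion fun n => (hK n).isClosed.measurableSet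

/-- The parameters for which a continuous family of maps is almost surjective form a
measurable set. -/
theorem measurableSet_almostSurjective {Θ X Y : Type*} [TopologicalSpace Θ] [TopologicalSpace X]
    [TopologicalSpace Y] [MeasurableSpace Θ] [MeasureSpace Y] [SFinite (volume : Measure Y)]
    [SigmaCompactSpace Θ] [SigmaCompactSpace X] [T2Space Θ] [T2Space Y]
    [OpensMeasurableSpace Θ] [OpensMeasurableSpace Y] [SecondCountableTopologyEither Θ Y]
    {f : Θ → X → Y} (hf : Continuous fun p : Θ × X => f p.1 p.2) :
    MeasurableSet {θ : Θ | AlmostSurjective (f θ)} := by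
  have h := (measurableSet_image_graph hf).compl
  exact (measurable_measure_prodMk_left (ν := (volume : Measure Y)) h)
    (measurableSet_singleton 0)

/-- Almost every point has a preimage with any given property that holds almost everywhere, since
a differentiable map sends null sets to null sets. -/
theorem AlmostSurjective.ae_exists_and {E : Type*} [NormedAddCommGroup E] [NormedSpace ℝ E]
    [FiniteDimensional ℝ E] [MeasureSpace E] [BorelSpace E]
    [(volume : Measure E).IsAddHaarMeasure] {f : E → E} (hf : AlmostSurjective f)
    (hd : Differentiable ℝ f) {P : E → Prop} (hP : ∀ᵐ x, P x) :
    ∀ᵐ y : E, ∃ x, f x = y ∧ P x := by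
  have himg : (volume : Measure E) (f '' {x | ¬ P x}) = 0 :=
    addHaar_image_eq_zero_of_differentiableOn_of_addHaar_eq_zero _ hd.differentiableOn hP
  have hn : ∀ᵐ y : E, y ∉ f '' {x | ¬ P x} := by
    rw [ae_iff]
    simpa only [not_not, ofPred_mem_eq] using himg
  filter_upwards [hf, hn] with y hy hny
  obtain ⟨x, rfl⟩ := hy
  refine ⟨x, rfl, ?_⟩
  by_contra hx
  exact hny ⟨x, hx, rfl⟩

/-- A `C¹` map sends a Lebesgue null set to a set that is null for the Hausdorff measure in the
dimension of the source. -/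
theorem hausdorffMeasure_image_eq_zero_of_contDiff {E F : Type*} [NormedAddCommGroup E]
    [NormedSpace ℝ E] [FiniteDimensional ℝ E] [MeasurableSpace E] [BorelSpace E]
    [NormedAddCommGroup F] [NormedSpace ℝ F] [MeasurableSpace F] [BorelSpace F]
    (μ : Measure E) [μ.IsAddHaarMeasure] {f : E → F} (hf : ContDiff ℝ 1 f) {s : Set E}
    (hs : μ s = 0) : μH[Module.finrank ℝ E] (f '' s) = 0 := by
  have hs' : μH[Module.finrank ℝ E] s = 0 :=
    Measure.absolutelyContinuous_isAddHaarMeasure _ μ hs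
  -- A `C¹` map is Lipschitz only on bounded sets, hence the cut into balls.
  have hcov : f '' s ⊆ ⋃ n : ℕ, f '' (s ∩ Metric.closedBall 0 n) := by
    rintro _ ⟨x, hx, rfl⟩
    obtain ⟨n, hn⟩ := exists_nat_ge ‖x‖
    exact mem_iUnion.2 ⟨n, x, ⟨hx, by simpa using hn⟩, rfl⟩
  refine measure_mono_null hcov (measure_iUnion_null fun n => ?_)
  obtain ⟨K, hK⟩ := hf.contDiffOn.exists_lipschitzOnWith one_ne_zero
    (convex_closedBall (0 : E) n) (isCompact_closedBall (0 : E) n)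
  have hle := (hK.mono (inter_subset_right (s := s))).hausdorffMeasure_image_le
    (d := Module.finrank ℝ E) (Nat.cast_nonneg _)
  rw [measure_mono_null inter_subset_left hs', mul_zero] at hle
  exact le_antisymm hle (zero_le)

/-! ### Solving the single-token equation -/

section Resolvent

variable {d : ℕ}

/-- The polynomial family of matrices `B` with `(M + l) * B l = p l`, where `p` is the minimal
polynomial of `-M`. -/
noncomputable def resolventNumerator (M : Matrix (Fin d) (Fin d) ℝ) (l : ℝ) :
    Matrix (Fin d) (Fin d) ℝ :=
  Polynomial.aeval (-M) (minpoly ℝ (-M) /ₘ (Polynomial.X - Polynomial.C l))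

/-- Evaluate `(X - l) * q = p - p(l)` at `-M`, which annihilates `p`. -/
theorem add_smul_mul_resolventNumerator (M : Matrix (Fin d) (Fin d) ℝ) (l : ℝ) :
    (M + l • 1) * resolventNumerator M l = (minpoly ℝ (-M)).eval l • 1 := by
  have h := Polynomial.X_sub_C_mul_divByMonic_eq_sub_modByMonic (minpoly ℝ (-M)) l
  rw [Polynomial.modByMonic_X_sub_C_eq_C_eval] at h
  have h2 := congrArg (Polynomial.aeval (-M)) h
  simp only [map_mul, map_sub, Polynomial.aeval_X, Polynomial.aeval_C, minpoly.aeval,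
    zero_sub, Algebra.algebraMap_eq_smul_one] at h2
  rw [resolventNumerator, ← neg_inj, ← h2, ← neg_mul]
  congr 1
  abel

theorem add_smul_mulVec_resolventNumerator (M : Matrix (Fin d) (Fin d) ℝ) (l : ℝ)
    (b : Fin d → ℝ) :
    M *ᵥ (resolventNumerator M l *ᵥ b) + l • (resolventNumerator M l *ᵥ b) =
      (minpoly ℝ (-M)).eval l • b := by
  have h := congrArg (· *ᵥ b) (add_smul_mul_resolventNumerator M l)
  simpa [← Matrix.mulVec_mulVec, Matrix.add_mulVec, Matrix.smul_mulVec] using h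

/-- Otherwise `p / (X - l)` would annihilate `-M` with degree below that of `p`. -/
theorem resolventNumerator_ne_zero {M : Matrix (Fin d) (Fin d) ℝ} {l : ℝ}
    (hl : (minpoly ℝ (-M)).IsRoot l) : resolventNumerator M l ≠ 0 := by
  intro h0
  have hint : IsIntegral ℝ (-M) := Algebra.IsIntegral.isIntegral _
  have hmul := Polynomial.mul_divByMonic_eq_iff_isRoot.2 hl
  have hne : minpoly ℝ (-M) /ₘ (Polynomial.X - Polynomial.C l) ≠ 0 := by
    intro h
    rw [h, mul_zero] at hmul
    exact minpoly.ne_zero hint hmul.symm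
  have hdeg := minpoly.degree_le_of_ne_zero ℝ (-M) hne h0
  have hlt : (minpoly ℝ (-M) /ₘ (Polynomial.X - Polynomial.C l)).degree <
      (minpoly ℝ (-M)).degree := by
    conv_rhs => rw [← hmul]
    rw [Polynomial.degree_mul, Polynomial.degree_X_sub_C, add_comm,
      Polynomial.degree_eq_natDegree hne]
    exact_mod_cast Nat.lt_succ_self _
  exact absurd hdeg (not_le.2 hlt)

/-- The coefficients of the quotient by `X - l` are explicit polynomials in `l`. -/
theorem continuous_resolventNumerator (M : Matrix (Fin d) (Fin d) ℝ) :
    Continuous (resolventNumerator M) := by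
  have heq : resolventNumerator M = fun l => ∑ n ∈ Finset.range ((minpoly ℝ (-M)).natDegree + 1),
      (∑ i ∈ Finset.Icc (n + 1) (minpoly ℝ (-M)).natDegree,
        l ^ (i - (n + 1)) * (minpoly ℝ (-M)).coeff i) • (-M) ^ n := by
    funext l
    have hdeg : (minpoly ℝ (-M) /ₘ (Polynomial.X - Polynomial.C l)).natDegree <
        (minpoly ℝ (-M)).natDegree + 1 := by
      rw [Polynomial.natDegree_divByMonic _ (Polynomial.monic_X_sub_C l)]
      omega
    rw [resolventNumerator, Polynomial.aeval_eq_sum_range' hdeg]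
    simp_rw [Polynomial.coeff_divByMonic_X_sub_C]
  rw [heq]
  fun_prop

theorem exists_norm_mulVec_le (M : Matrix (Fin d) (Fin d) ℝ) :
    ∃ C : ℝ, ∀ x : Fin d → ℝ, ‖M *ᵥ x‖ ≤ C * ‖x‖ :=
  ⟨‖(Matrix.mulVecLin M).toContinuousLinearMap‖,
    fun x => (Matrix.mulVecLin M).toContinuousLinearMap.le_opNorm x⟩

/-- Solutions of `(M + l) x = b` have bounded quadratic form for large `|l|`. -/
theorem exists_abs_quadratic_le (M N : Matrix (Fin d) (Fin d) ℝ) (b : Fin d → ℝ) :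
    ∃ R : ℝ, ∀ l : ℝ, R < |l| → ∀ x : Fin d → ℝ, M *ᵥ x + l • x = b →
      |x ⬝ᵥ (N *ᵥ x)| < |l| := by
  obtain ⟨C, hC⟩ := exists_norm_mulVec_le M
  have hcont : Continuous fun x : Fin d → ℝ => x ⬝ᵥ (N *ᵥ x) := by fun_prop
  obtain ⟨D, hD⟩ := (isCompact_closedBall (0 : Fin d → ℝ) ‖b‖).exists_bound_of_continuousOn
    hcont.continuousOn
  -- `|l| > C + 1` forces `‖x‖ ≤ ‖b‖`, and `D` bounds the quadratic form on that ball.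
  refine ⟨max (C + 1) D, fun l hl x hx => ?_⟩
  have hlx : |l| * ‖x‖ ≤ ‖b‖ + C * ‖x‖ := by
    have : l • x = b - M *ᵥ x := by rw [← hx]; abel
    calc |l| * ‖x‖ = ‖l • x‖ := by rw [norm_smul, Real.norm_eq_abs]
      _ = ‖b - M *ᵥ x‖ := by rw [this]
      _ ≤ ‖b‖ + ‖M *ᵥ x‖ := norm_sub_le _ _
      _ ≤ _ := by gcongr; exact hC x
  have hxb : ‖x‖ ≤ ‖b‖ := by
    have h1 : (C + 1) * ‖x‖ ≤ |l| * ‖x‖ :=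
      mul_le_mul_of_nonneg_right ((le_max_left _ _).trans hl.le) (norm_nonneg x)
    linarith
  calc |x ⬝ᵥ (N *ᵥ x)| ≤ D := hD x (by simpa using hxb)
    _ ≤ _ := le_max_right _ _
    _ < _ := hl

/-- For `b` outside the zero sets of finitely many quadratic forms, the single-token equation has
a solution. -/
theorem exists_tokenMap_eq (M N : Matrix (Fin d) (Fin d) ℝ) (b : Fin d → ℝ)
    (hb : ∀ l : ℝ, (minpoly ℝ (-M)).IsRoot l →
      (resolventNumerator M l *ᵥ b) ⬝ᵥ (N *ᵥ (resolventNumerator M l *ᵥ b)) ≠ 0) :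
    ∃ x, tokenMap M N x = b := by
  set p := minpoly ℝ (-M) with hp
  have hp0 : p ≠ 0 := minpoly.ne_zero (Algebra.IsIntegral.isIntegral _)
  let y : ℝ → Fin d → ℝ := fun l => resolventNumerator M l *ᵥ b
  let g : ℝ → ℝ := fun l => l * p.eval l ^ 2 - y l ⬝ᵥ (N *ᵥ y l)
  have hBc := continuous_resolventNumerator M
  have hgc : Continuous g := by
    have hpc := p.continuous
    fun_prop
  have hsol (l : ℝ) (hl : p.eval l ≠ 0) :
      M *ᵥ ((p.eval l)⁻¹ • y l) + l • ((p.eval l)⁻¹ • y l) = b := by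
    rw [Matrix.mulVec_smul, smul_comm l, ← smul_add, add_smul_mulVec_resolventNumerator,
      smul_smul, inv_mul_cancel₀ hl, one_smul]
  have hg (l : ℝ) (hl : p.eval l ≠ 0) : g l = p.eval l ^ 2 *
      (l - ((p.eval l)⁻¹ • y l) ⬝ᵥ (N *ᵥ ((p.eval l)⁻¹ • y l))) := by
    simp only [g, Matrix.mulVec_smul, smul_dotProduct, dotProduct_smul, smul_eq_mul]
    field_simp
  obtain ⟨R, hR⟩ := exists_abs_quadratic_le M N b
  have hfin : {l : ℝ | p.eval l = 0}.Finite := by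
    simpa [Polynomial.IsRoot] using Polynomial.finite_setOfPred_isRoot hp0
  -- The test points avoid the roots of `p`, so that the solution `y / p l` exists there and the
  -- sign of `g` is that of `l`.
  obtain ⟨u, hu, hur⟩ := (Ioi_infinite (max R 0)).exists_notMem_finite hfin
  obtain ⟨v, hv, hvr⟩ := (Iio_infinite (min (-R) 0)).exists_notMem_finite hfin
  simp only [mem_Ioi, sup_lt_iff, mem_Iio, lt_inf_iff, mem_ofPred_eq] at hu hur hv hvr
  have hgu : 0 < g u := by
    have h := hR u (by rw [abs_of_pos hu.2]; exact hu.1) _ (hsol u hur)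
    rw [abs_of_pos hu.2] at h
    rw [hg u hur]
    have := (abs_lt.1 h).2
    exact mul_pos (by positivity) (by linarith)
  have hgv : g v < 0 := by
    have h := hR v (by rw [abs_of_neg hv.2]; linarith) _ (hsol v hvr)
    rw [abs_of_neg hv.2] at h
    rw [hg v hvr]
    have := (abs_lt.1 h).1
    exact mul_neg_of_pos_of_neg (by positivity) (by linarith)
  obtain ⟨l, hl⟩ := mem_range_of_exists_le_of_exists_ge hgc ⟨v, hgv.le⟩ ⟨u, hgu.le⟩
  have hpl : p.eval l ≠ 0 := by
    intro h
    apply hb l h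
    have hy : y l ⬝ᵥ (N *ᵥ y l) = 0 := by simpa [g, h] using hl
    exact hy
  refine ⟨(p.eval l)⁻¹ • y l, ?_⟩
  have hq : ((p.eval l)⁻¹ • y l) ⬝ᵥ (N *ᵥ ((p.eval l)⁻¹ • y l)) = l := by
    rw [hg l hpl] at hl
    have := (mul_eq_zero.1 hl).resolve_left (pow_ne_zero 2 hpl)
    linarith
  rw [tokenMap, hq, hsol l hpl]

/-- A criterion for almost surjectivity of the single-token map: for every real eigenvalue, the
quadratic form of `N` does not vanish on the range of the numerator of the resolvent. -/
theorem almostSurjective_tokenMap (M N : Matrix (Fin d) (Fin d) ℝ)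
    (h : ∀ l : ℝ, (minpoly ℝ (-M)).IsRoot l → ∃ b : Fin d → ℝ,
      (resolventNumerator M l *ᵥ b) ⬝ᵥ (N *ᵥ (resolventNumerator M l *ᵥ b)) ≠ 0) :
    AlmostSurjective (tokenMap M N) := by
  have hfin : {l : ℝ | (minpoly ℝ (-M)).IsRoot l}.Finite :=
    Polynomial.finite_setOfPred_isRoot (minpoly.ne_zero (Algebra.IsIntegral.isIntegral _))
  have hae : ∀ᵐ b : Fin d → ℝ, ∀ l ∈ {l : ℝ | (minpoly ℝ (-M)).IsRoot l},
      (resolventNumerator M l *ᵥ b) ⬝ᵥ (N *ᵥ (resolventNumerator M l *ᵥ b)) ≠ 0 := by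
    rw [ae_ball_iff hfin.countable]
    intro l hl
    obtain ⟨b, hb⟩ := h l hl
    refine ae_ne_zero_of_contDiff_omega volume ?_ hb
    simp only [dotProduct, Matrix.mulVec]
    fun_prop
  filter_upwards [hae] with b hb
  exact exists_tokenMap_eq M N b hb

end Resolvent

/-! ### Matrices of fixed rank -/

section FixedRank

variable {d : ℕ}

/-- Parameters of the matrices whose row space is spanned by the rows with index in `I`: those
rows, and the coefficients of the other rows. -/
abbrev RowParam (I : Finset (Fin d)) : Type :=
  (I → Fin d → ℝ) × ({i // i ∉ I} → I → ℝ)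

instance isAddHaarMeasure_volume_rowParam (I : Finset (Fin d)) :
    (volume : Measure (RowParam I)).IsAddHaarMeasure :=
  Measure.prod.instIsAddHaarMeasure _ _

/-- The matrix with given rows in `I` and given coefficients of the other rows. -/
def rowChart (I : Finset (Fin d)) (p : RowParam I) : Entries d :=
  fun i => if h : i ∈ I then p.1 ⟨i, h⟩ else ∑ j, p.2 ⟨i, h⟩ j • p.1 j

theorem contDiff_rowChart (I : Finset (Fin d)) : ContDiff ℝ ω (rowChart I) := by
  rw [contDiff_pi]
  intro i
  by_cases h : i ∈ I
  · simp only [rowChart, h, dite_true]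
    fun_prop
  · simp only [rowChart, h, dite_false]
    fun_prop

/-- Take for `I` the indices of a maximal independent family of rows. The images of the charts may
contain matrices of smaller rank; only covering matters. -/
theorem exists_rowChart_eq {A : Entries d} {r : ℕ} (hA : (Matrix.of A).rank = r) :
    ∃ I : Finset (Fin d), I.card = r ∧ ∃ p, rowChart I p = A := by
  classical
  obtain ⟨κ, a, ha, hsp, hli⟩ := exists_linearIndependent' ℝ A
  have : Finite κ := Finite.of_injective a ha
  have := Fintype.ofFinite κ
  let I : Finset (Fin d) := Finset.univ.image a
  have hspI : Submodule.span ℝ (range fun j : I => A j) = Submodule.span ℝ (range A) := by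
    rw [← hsp]
    congr 1
    ext x
    simp [I]
  have hcard : I.card = r := by
    rw [Finset.card_image_of_injective _ ha, ← hA, Matrix.rank_eq_finrank_span_row,
      Finset.card_univ]
    change _ = Module.finrank ℝ (Submodule.span ℝ (range A))
    rw [← hsp, finrank_span_eq_card hli]
  have hmem (i : Fin d) : ∃ c : I → ℝ, ∑ j, c j • A j = A i := by
    rw [← Submodule.mem_span_range_iff_exists_fun ℝ, hspI]
    exact Submodule.subset_span (mem_range_self i)
  choose c hc using hmem
  refine ⟨I, hcard, (fun j => A j, fun i => c i), ?_⟩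
  funext i
  by_cases h : i ∈ I
  · simp [rowChart, h]
  · simp only [rowChart, h, dite_false]
    exact hc i

/-- A rank-one matrix `c uᵀ` with `u ⬝ᵥ c ≠ 0` works, if its rows outside `I` are combinations of
those in `I`. -/
theorem exists_rowChart_quadratic_ne_zero {I : Finset (Fin d)} (hI : I.Nonempty)
    {u : Fin d → ℝ} (hu : u ≠ 0) :
    ∃ p : RowParam I, u ⬝ᵥ (Matrix.of (rowChart I p) *ᵥ u) ≠ 0 := by
  classical
  have huu : u ⬝ᵥ u ≠ 0 := by simpa using hu
  suffices h : ∃ c : Fin d → ℝ, u ⬝ᵥ c ≠ 0 ∧ ∃ p : RowParam I,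
      ∀ i, rowChart I p i = c i • u by
    obtain ⟨c, hc, p, hp⟩ := h
    refine ⟨p, ?_⟩
    have : Matrix.of (rowChart I p) *ᵥ u = (u ⬝ᵥ u) • c := by
      funext i
      change rowChart I p i ⬝ᵥ u = _
      rw [hp, smul_dotProduct, Pi.smul_apply, smul_eq_mul, smul_eq_mul, mul_comm]
    rw [this, dotProduct_smul]
    exact mul_ne_zero huu hc
  by_cases hz : ∃ j ∈ I, u j ≠ 0
  · obtain ⟨j, hj, huj⟩ := hz
    refine ⟨Pi.single j 1, by simpa using huj,
      (fun i => (Pi.single j 1 : Fin d → ℝ) i • u, 0), fun i => ?_⟩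
    by_cases h : i ∈ I
    · simp [rowChart, h]
    · have hij : i ≠ j := fun e => h (e ▸ hj)
      simp [rowChart, h, hij]
  -- Here `u` vanishes on `I`; adding `e_j` to `c` makes row `j` equal to `u`, so that it spans the
  -- other rows, and leaves `u ⬝ᵥ c = u ⬝ᵥ u`.
  · push Not at hz
    obtain ⟨j, hj⟩ := hI
    refine ⟨u + Pi.single j 1, by simpa [hz j hj] using huu,
      (fun i => (u + Pi.single j 1 : Fin d → ℝ) i • u, fun i => u i • Pi.single ⟨j, hj⟩ 1),
      fun i => ?_⟩
    by_cases h : i ∈ I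
    · simp [rowChart, h]
    · have hij : i ≠ j := fun e => h (e ▸ hj)
      simp only [rowChart, h, dite_false]
      rw [Finset.sum_eq_single ⟨j, hj⟩]
      · simp [hij, hz j hj]
      · intro k _ hk
        simp [hk]
      · simp

/-- `M` is arbitrary: it contributes finitely many roots, each with one vector in the range of `B l`
on which the form must not vanish. -/
theorem ae_almostSurjective_tokenMap_rowChart (M : Matrix (Fin d) (Fin d) ℝ)
    {I : Finset (Fin d)} (hI : I.Nonempty) :
    ∀ᵐ p : RowParam I, AlmostSurjective (tokenMap M (Matrix.of (rowChart I p))) := by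
  have hfin : {l : ℝ | (minpoly ℝ (-M)).IsRoot l}.Finite :=
    Polynomial.finite_setOfPred_isRoot (minpoly.ne_zero (Algebra.IsIntegral.isIntegral _))
  have hae : ∀ᵐ p : RowParam I, ∀ l ∈ {l : ℝ | (minpoly ℝ (-M)).IsRoot l}, ∃ b,
      (resolventNumerator M l *ᵥ b) ⬝ᵥ
        (Matrix.of (rowChart I p) *ᵥ (resolventNumerator M l *ᵥ b)) ≠ 0 := by
    rw [ae_ball_iff hfin.countable]
    intro l hl
    obtain ⟨b, hb⟩ : ∃ b, resolventNumerator M l *ᵥ b ≠ 0 := by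
      by_contra! h
      exact resolventNumerator_ne_zero hl (Matrix.mulVec_injective (by funext b; simp [h b]))
    obtain ⟨p₀, hp₀⟩ := exists_rowChart_quadratic_ne_zero hI hb
    have hcd := contDiff_rowChart I
    have hae := ae_ne_zero_of_contDiff_omega (volume : Measure (RowParam I))
      (q := fun p => (resolventNumerator M l *ᵥ b) ⬝ᵥ
        (Matrix.of (rowChart I p) *ᵥ (resolventNumerator M l *ᵥ b))) ?_ hp₀
    · filter_upwards [hae] with p hp
      exact ⟨b, hp⟩
    · have hcd' (i j : Fin d) : ContDiff ℝ ω fun p => rowChart I p i j :=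
        contDiff_pi.1 (contDiff_pi.1 hcd i) j
      generalize resolventNumerator M l *ᵥ b = u
      simp only [dotProduct, Matrix.mulVec, Matrix.of_apply]
      fun_prop
  filter_upwards [hae] with p hp
  exact almostSurjective_tokenMap _ _ hp

theorem ae_almostSurjective_tokenMap_rowChart_prod (I J : Finset (Fin d)) (hJ : J.Nonempty) :
    ∀ᵐ p ∂(volume : Measure (RowParam I)).prod (volume : Measure (RowParam J)),
      AlmostSurjective (tokenMap (Matrix.of (rowChart I p.1)) (Matrix.of (rowChart J p.2))) := by
  have hI := (contDiff_rowChart I).continuous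
  have hJ' := (contDiff_rowChart J).continuous
  have : BorelSpace (RowParam I × RowParam J) := Prod.borelSpace
  have hm : MeasurableSet {p : RowParam I × RowParam J |
      AlmostSurjective (tokenMap (Matrix.of (rowChart I p.1)) (Matrix.of (rowChart J p.2)))} := by
    refine measurableSet_almostSurjective
      (f := fun p : RowParam I × RowParam J =>
        tokenMap (Matrix.of (rowChart I p.1)) (Matrix.of (rowChart J p.2))) ?_
    have h1 : Continuous fun p : (RowParam I × RowParam J) × (Fin d → ℝ) =>
        Matrix.of (rowChart I p.1.1) := hI.comp (by fun_prop)
    have h2 : Continuous fun p : (RowParam I × RowParam J) × (Fin d → ℝ) =>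
        Matrix.of (rowChart J p.1.2) := hJ'.comp (by fun_prop)
    unfold tokenMap
    fun_prop
  refine (Measure.measure_prod_null hm.compl).2 ?_
  exact Eventually.of_forall fun p =>
    ae_almostSurjective_tokenMap_rowChart (Matrix.of (rowChart I p)) hJ

theorem finrank_rowParam (I : Finset (Fin d)) :
    (Module.finrank ℝ (RowParam I) : ℝ) = I.card * (2 * d - I.card) := by
  have hle : I.card ≤ d := by simpa using I.card_le_univ
  have hc : Fintype.card {i // i ∉ I} = d - I.card := by
    rw [Fintype.card_subtype_compl]
    simp
  simp only [RowParam, Module.finrank_prod, Module.finrank_pi_fintype, Module.finrank_self, mul_one,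
    Finset.sum_const, Finset.card_univ, hc, Fintype.card_fin, Fintype.card_coe, smul_eq_mul,
    Nat.cast_add, Nat.cast_mul, Nat.cast_sub hle]
  ring

/-- The Hausdorff exponent equals the dimension of each chart domain, so the `C¹` charts send null
sets of bad parameters to null sets. Injectivity of the charts plays no role. -/
theorem almostAlwaysSurjective_tokenMap {rM rN : ℕ} (hMd : rM ≤ d) (hN : 1 ≤ rN) (hNd : rN ≤ d) :
    AlmostAlwaysSurjective (fixedRankMeasure d rM rN)
      (fun θ (x : Fin d → ℝ) => tokenMap (Matrix.of θ.1.1) (Matrix.of θ.1.2) x) := by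
  rw [AlmostAlwaysSurjective, ae_iff, fixedRankMeasure]
  have hk : 0 ≤ (rM : ℝ) * (2 * d - rM) + (rN : ℝ) * (2 * d - rN) := by
    have h1 : (rM : ℝ) ≤ d := by exact_mod_cast hMd
    have h2 : (rN : ℝ) ≤ d := by exact_mod_cast hNd
    have h3 : (0 : ℝ) ≤ d := d.cast_nonneg
    have h4 : (0 : ℝ) ≤ 2 * d - rM := by linarith
    have h5 : (0 : ℝ) ≤ 2 * d - rN := by linarith
    positivity
  rw [← (isometry_subtype_coe (s := FixedRankPairs d rM rN)).hausdorffMeasure_image (Or.inl hk)]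
  let bad (I J : Finset (Fin d)) : Set (RowParam I × RowParam J) := {p |
    ¬ AlmostSurjective (tokenMap (Matrix.of (rowChart I p.1)) (Matrix.of (rowChart J p.2)))}
  have hcov : (Subtype.val '' {θ : FixedRankPairs d rM rN |
        ¬ AlmostSurjective (tokenMap (Matrix.of θ.1.1) (Matrix.of θ.1.2))}) ⊆
      ⋃ I ∈ {I : Finset (Fin d) | I.card = rM}, ⋃ J ∈ {J : Finset (Fin d) | J.card = rN},
        (Prod.map (rowChart I) (rowChart J)) '' bad I J := by
    rintro _ ⟨⟨⟨A, B⟩, hA, hB⟩, hbad, rfl⟩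
    obtain ⟨I, hI, p, rfl⟩ := exists_rowChart_eq hA
    obtain ⟨J, hJ, q, rfl⟩ := exists_rowChart_eq hB
    simp only [mem_iUnion]
    exact ⟨I, hI, J, hJ, (p, q), hbad, rfl⟩
  refine measure_mono_null hcov ?_
  rw [measure_biUnion_null_iff (to_countable _)]
  intro I hI
  rw [measure_biUnion_null_iff (to_countable _)]
  intro J hJ
  have hdim : (rM : ℝ) * (2 * d - rM) + (rN : ℝ) * (2 * d - rN) =
      Module.finrank ℝ (RowParam I × RowParam J) := by
    rw [Module.finrank_prod, Nat.cast_add, finrank_rowParam, finrank_rowParam, hI, hJ]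
  rw [hdim]
  have hJne : J.Nonempty := Finset.card_pos.1 (hJ ▸ hN)
  have : BorelSpace (RowParam I × RowParam J) := Prod.borelSpace
  have hadd (K : Finset (Fin d)) : MeasurableAdd (RowParam K) := ContinuousAdd.measurableAdd
  have : ((volume : Measure (RowParam I)).prod (volume : Measure (RowParam J))).IsAddHaarMeasure :=
    Measure.prod.instIsAddHaarMeasure _ _
  refine hausdorffMeasure_image_eq_zero_of_contDiff
    ((volume : Measure (RowParam I)).prod (volume : Measure (RowParam J))) ?_
    (ae_almostSurjective_tokenMap_rowChart_prod I J hJne)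
  exact (((contDiff_rowChart I).comp contDiff_fst).prodMk
    ((contDiff_rowChart J).comp contDiff_snd)).of_le le_top

end FixedRank

/-! ### Retention layers -/

section Layer

variable {d m : ℕ}

theorem contDiff_det {E : Type*} [NormedAddCommGroup E] [NormedSpace ℝ E] {n : WithTop ℕ∞}
    {ι : Type*} [Fintype ι] [DecidableEq ι] {A : E → Matrix ι ι ℝ}
    (hA : ∀ i j, ContDiff ℝ n fun x => A x i j) : ContDiff ℝ n fun x => (A x).det := by
  simp only [Matrix.det_apply']
  exact ContDiff.sum fun σ _ => contDiff_const.mul (contDiff_prod fun i _ => hA _ _)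

/-- The matrix `∑ j, a_j a_jᵀ A` by which earlier tokens act on the next one. -/
def prefixMatrix (A : Matrix (Fin d) (Fin d) ℝ) (a : Fin m → Fin d → ℝ) :
    Matrix (Fin d) (Fin d) ℝ :=
  (Matrix.of a)ᵀ * Matrix.of a * A

/-- The matrix of the bilinear form of `A` on a family of vectors. -/
def formGram (A : Matrix (Fin d) (Fin d) ℝ) (a : Fin m → Fin d → ℝ) :
    Matrix (Fin m) (Fin m) ℝ :=
  Matrix.of a * A * (Matrix.of a)ᵀ

theorem prefixMatrix_mulVec (A : Matrix (Fin d) (Fin d) ℝ) (a : Fin m → Fin d → ℝ)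
    (x : Fin d → ℝ) :
    prefixMatrix A a *ᵥ x = (Matrix.of a)ᵀ *ᵥ (Matrix.of a *ᵥ (A *ᵥ x)) := by
  simp [prefixMatrix, Matrix.mulVec_mulVec, Matrix.mul_assoc]

theorem formGram_mulVec (A : Matrix (Fin d) (Fin d) ℝ) (a : Fin m → Fin d → ℝ)
    (t : Fin m → ℝ) :
    formGram A a *ᵥ t = Matrix.of a *ᵥ (A *ᵥ ((Matrix.of a)ᵀ *ᵥ t)) := by
  simp [formGram, Matrix.mulVec_mulVec, Matrix.mul_assoc]

theorem contDiff_det_formGram {E : Type*} [NormedAddCommGroup E] [NormedSpace ℝ E]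
    {n : WithTop ℕ∞} {A : E → Matrix (Fin d) (Fin d) ℝ} {a : E → Fin m → Fin d → ℝ}
    (hA : ∀ i j, ContDiff ℝ n fun x => A x i j) (ha : ∀ i j, ContDiff ℝ n fun x => a x i j) :
    ContDiff ℝ n fun x => (formGram (A x) (a x)).det := by
  refine contDiff_det fun i j => ?_
  simp only [formGram, Matrix.mul_apply, Matrix.of_apply, Matrix.transpose_apply]
  fun_prop

/-- Eigenvectors of a prefix matrix for non-zero eigenvalues are not isotropic. -/
theorem quadratic_ne_zero_of_eigenvector {A : Matrix (Fin d) (Fin d) ℝ}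
    {a : Fin m → Fin d → ℝ} {l : ℝ} (hl : l ≠ 0) {u : Fin d → ℝ} (hu : u ≠ 0)
    (h : prefixMatrix A a *ᵥ u + l • u = 0) : u ⬝ᵥ (A *ᵥ u) ≠ 0 := by
  intro h0
  rw [prefixMatrix_mulVec] at h
  -- Pairing with `A u` leaves the squared Euclidean norm of `a A u`, which is therefore `0`, and
  -- then `l u = 0`.
  have h1 := congrArg (· ⬝ᵥ (A *ᵥ u)) h
  simp only [add_dotProduct, smul_dotProduct, h0, smul_zero, add_zero, zero_dotProduct,
    Matrix.mulVec_transpose, ← Matrix.dotProduct_mulVec, dotProduct_self_eq_zero] at h1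
  rw [h1] at h
  simp [hl, hu] at h

/-- If `M` is semisimple at `0`, the numerator of the resolvent at `0` maps onto the kernel. -/
theorem exists_resolventNumerator_zero_mulVec_eq {M : Matrix (Fin d) (Fin d) ℝ}
    (hroot : (minpoly ℝ (-M)).IsRoot 0) (hM : ∀ x, M *ᵥ (M *ᵥ x) = 0 → M *ᵥ x = 0)
    {u : Fin d → ℝ} (hu : M *ᵥ u = 0) : ∃ b, resolventNumerator M 0 *ᵥ b = u := by
  set g := minpoly ℝ (-M) /ₘ (Polynomial.X - Polynomial.C 0) with hg
  have hB : resolventNumerator M 0 =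
      Polynomial.aeval (-M) g.divX * (-M) + g.coeff 0 • 1 := by
    conv_lhs => rw [resolventNumerator, ← hg, ← Polynomial.divX_mul_X_add g]
    simp [Algebra.algebraMap_eq_smul_one]
  have hBu : resolventNumerator M 0 *ᵥ u = g.coeff 0 • u := by
    rw [hB, Matrix.add_mulVec, ← Matrix.mulVec_mulVec, Matrix.neg_mulVec, hu, neg_zero,
      Matrix.mulVec_zero, zero_add, Matrix.smul_mulVec, Matrix.one_mulVec]
  -- `B 0 = g(-M)` acts on the kernel as the scalar `g(0)`. If this were `0`, then `B 0 = -M h(-M)`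
  -- with `M (B 0) = 0`, and semisimplicity would give `B 0 = 0`.
  have hc : g.coeff 0 ≠ 0 := by
    intro hc
    have hB' : resolventNumerator M 0 = -M * Polynomial.aeval (-M) g.divX := by
      have h := ((Polynomial.commute_X g.divX).map (Polynomial.aeval (-M))).eq
      rw [Polynomial.aeval_X] at h
      rw [hB, hc, zero_smul, add_zero, h]
    apply resolventNumerator_ne_zero hroot
    apply Matrix.mulVec_injective
    funext b
    have h0 : M *ᵥ (resolventNumerator M 0 *ᵥ b) = 0 := by
      have h := add_smul_mulVec_resolventNumerator M 0 b
      rw [hroot] at h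
      simpa using h
    rw [hB', ← Matrix.mulVec_mulVec, Matrix.neg_mulVec, Matrix.mulVec_neg, neg_eq_zero] at h0
    rw [hB', ← Matrix.mulVec_mulVec, Matrix.neg_mulVec, hM _ h0]
    simp
  refine ⟨(g.coeff 0)⁻¹ • u, ?_⟩
  rw [Matrix.mulVec_smul, hBu, smul_smul, inv_mul_cancel₀ hc, one_smul]

/-- With `t = a A x` and `G` the Gram matrix, applying `a A` to the hypothesis gives `G (G t) = 0`,
so `t = 0`. -/
theorem prefixMatrix_semisimple {A : Matrix (Fin d) (Fin d) ℝ} {a : Fin m → Fin d → ℝ}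
    (hG : (formGram A a).det ≠ 0) (x : Fin d → ℝ)
    (hx : prefixMatrix A a *ᵥ (prefixMatrix A a *ᵥ x) = 0) : prefixMatrix A a *ᵥ x = 0 := by
  rw [prefixMatrix_mulVec, prefixMatrix_mulVec A a x, ← formGram_mulVec] at hx
  have h := congrArg (fun v => Matrix.of a *ᵥ (A *ᵥ v)) hx
  simp only [← formGram_mulVec, Matrix.mulVec_zero] at h
  have h2 := Matrix.eq_zero_of_mulVec_eq_zero hG (Matrix.eq_zero_of_mulVec_eq_zero hG h)
  rw [prefixMatrix_mulVec, h2, Matrix.mulVec_zero]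

/-- Two consecutive non-degenerate Gram matrices give a non-isotropic vector in the kernel of a
prefix matrix. -/
theorem exists_prefixMatrix_mulVec_eq_zero {A : Matrix (Fin d) (Fin d) ℝ}
    {a : Fin m → Fin d → ℝ} {w : Fin d → ℝ} (hG : (formGram A a).det ≠ 0)
    (hG' : (formGram A (Fin.snoc a w : Fin (m + 1) → Fin d → ℝ)).det ≠ 0) :
    ∃ u, prefixMatrix A a *ᵥ u = 0 ∧ u ⬝ᵥ (A *ᵥ u) ≠ 0 := by
  set a' : Fin (m + 1) → Fin d → ℝ := Fin.snoc a w with ha'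
  let s : Fin (m + 1) → ℝ := (formGram A a')⁻¹ *ᵥ Pi.single (Fin.last m) 1
  have hs : formGram A a' *ᵥ s = Pi.single (Fin.last m) 1 := by
    rw [Matrix.mulVec_mulVec, Matrix.mul_nonsing_inv _ (isUnit_iff_ne_zero.2 hG'),
      Matrix.one_mulVec]
  let u : Fin d → ℝ := (Matrix.of a')ᵀ *ᵥ s
  rw [formGram_mulVec] at hs
  change Matrix.of a' *ᵥ (A *ᵥ u) = _ at hs
  have hTu : Matrix.of a *ᵥ (A *ᵥ u) = 0 := by
    funext j
    have h := congrFun hs j.castSucc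
    simpa [Matrix.mulVec, ha', (Fin.castSucc_lt_last j).ne] using h
  refine ⟨u, by rw [prefixMatrix_mulVec, hTu, Matrix.mulVec_zero], ?_⟩
  have huA : u ⬝ᵥ (A *ᵥ u) = s (Fin.last m) := by
    conv_lhs => enter [1]; change (Matrix.of a')ᵀ *ᵥ s
    rw [Matrix.mulVec_transpose, ← Matrix.dotProduct_mulVec, hs]
    simp
  rw [huA]
  -- If the last coefficient vanished, `u` would lie in the span of `a`, and non-degeneracy there
  -- would give `u = 0`.
  intro hlast
  have hu : u = (Matrix.of a)ᵀ *ᵥ (fun j => s j.castSucc) := by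
    funext i
    simp [u, Matrix.mulVec, dotProduct, Fin.sum_univ_castSucc, hlast, ha']
  rw [hu, ← formGram_mulVec] at hTu
  have hz := Matrix.eq_zero_of_mulVec_eq_zero hG hTu
  rw [hz, Matrix.mulVec_zero] at hu
  have h := congrFun hs (Fin.last m)
  simp [hu] at h

/-- Non-degeneracy of a matrix, as a bilinear form on generic subspaces of every dimension. -/
def GenericForm (A : Matrix (Fin d) (Fin d) ℝ) : Prop :=
  ∀ m ≤ d, ∃ a : Fin m → Fin d → ℝ, (formGram A a).det ≠ 0

theorem GenericForm.det_ne_zero {A : Matrix (Fin d) (Fin d) ℝ} (hA : GenericForm A) :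
    A.det ≠ 0 := by
  obtain ⟨a, ha⟩ := hA d le_rfl
  rw [formGram, Matrix.det_mul, Matrix.det_mul] at ha
  exact right_ne_zero_of_mul (left_ne_zero_of_mul ha)

theorem almostSurjective_tokenMap_prefixMatrix {A : Matrix (Fin d) (Fin d) ℝ}
    {a : Fin m → Fin d → ℝ}
    (h : (prefixMatrix A a).det ≠ 0 ∨ ((formGram A a).det ≠ 0 ∧
      ∃ w, (formGram A (Fin.snoc a w : Fin (m + 1) → Fin d → ℝ)).det ≠ 0)) :
    AlmostSurjective (tokenMap (prefixMatrix A a) A) := by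
  refine almostSurjective_tokenMap _ _ fun l hl => ?_
  obtain ⟨b, hb⟩ : ∃ b, resolventNumerator (prefixMatrix A a) l *ᵥ b ≠ 0 := by
    by_contra! h
    exact resolventNumerator_ne_zero hl (Matrix.mulVec_injective (by funext b; simp [h b]))
  have hker := add_smul_mulVec_resolventNumerator (prefixMatrix A a) l b
  rw [hl, zero_smul] at hker
  rcases eq_or_ne l 0 with rfl | hl0
  · rw [zero_smul, add_zero] at hker
    rcases h with h | ⟨hG, w, hG'⟩
    · exact absurd (Matrix.eq_zero_of_mulVec_eq_zero h hker) hb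
    · obtain ⟨u, hu, huA⟩ := exists_prefixMatrix_mulVec_eq_zero hG hG'
      obtain ⟨b, rfl⟩ :=
        exists_resolventNumerator_zero_mulVec_eq hl (prefixMatrix_semisimple hG) hu
      exact ⟨b, huA⟩
  · exact ⟨b, quadratic_ne_zero_of_eigenvector hl0 hb hker⟩

theorem GenericForm.ae_almostSurjective {A : Matrix (Fin d) (Fin d) ℝ} (hA : GenericForm A)
    (m : ℕ) :
    ∀ᵐ a : Fin m → Fin d → ℝ, AlmostSurjective (tokenMap (prefixMatrix A a) A) := by
  rcases lt_or_ge m d with hm | hm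
  · obtain ⟨a₁, h₁⟩ := hA m hm.le
    obtain ⟨a₂, h₂⟩ := hA (m + 1) hm
    have ae₁ := ae_ne_zero_of_contDiff_omega (volume : Measure (Fin m → Fin d → ℝ))
      (q := fun a => (formGram A a).det)
      (contDiff_det_formGram (fun _ _ => contDiff_const) (fun _ _ => by fun_prop)) h₁
    -- The extra vector is frozen at the last entry of `a₂`; only the first `m` vary.
    have ae₂ := ae_ne_zero_of_contDiff_omega (volume : Measure (Fin m → Fin d → ℝ))
      (q := fun a => (formGram A
        (Fin.snoc a (a₂ (Fin.last m)) : Fin (m + 1) → Fin d → ℝ)).det) (x₀ := Fin.init a₂)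
      (contDiff_det_formGram (fun _ _ => contDiff_const) (fun i j => by
        induction i using Fin.lastCases with
        | last => simp only [Fin.snoc_last]; fun_prop
        | cast i => simp only [Fin.snoc_castSucc]; fun_prop))
      (by simpa using h₂)
    filter_upwards [ae₁, ae₂] with a h₁ h₂
    exact almostSurjective_tokenMap_prefixMatrix (Or.inr ⟨h₁, _, h₂⟩)
  -- A Gram matrix of `m + 1 > d` vectors is singular. Instead the prefix matrix is generically
  -- invertible, so `0` is not a root; the witness starts with the standard basis.
  · have ae₁ := ae_ne_zero_of_contDiff_omega (volume : Measure (Fin m → Fin d → ℝ))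
      (q := fun a => (prefixMatrix A a).det)
      (x₀ := fun i => if h : (i : ℕ) < d then Pi.single ⟨i, h⟩ 1 else 0)
      (contDiff_det fun i j => by
        simp only [prefixMatrix, Matrix.mul_apply, Matrix.of_apply, Matrix.transpose_apply]
        fun_prop) ?_
    · filter_upwards [ae₁] with a h
      exact almostSurjective_tokenMap_prefixMatrix (Or.inl h)
    · suffices h : (Matrix.of fun i : Fin m =>
          if h : (i : ℕ) < d then (Pi.single ⟨i, h⟩ 1 : Fin d → ℝ) else 0)ᵀ *
          (Matrix.of fun i : Fin m =>
          if h : (i : ℕ) < d then (Pi.single ⟨i, h⟩ 1 : Fin d → ℝ) else 0) = 1 by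
        simpa [prefixMatrix, h] using hA.det_ne_zero
      ext j k
      rw [Matrix.mul_apply, Finset.sum_eq_single (Fin.castLE hm j)]
      · simp [Matrix.one_apply, Pi.single_apply, eq_comm]
      · intro i _ hi
        have hij (h : (i : ℕ) < d) : j ≠ ⟨i, h⟩ := by
          rintro rfl
          exact hi rfl
        by_cases h : (i : ℕ) < d
        · simp [h, hij h]
        · simp [h]
      · simp

/-- The Retention layer with `KᵀQ = A` and `V = 1`. -/
def baseRet (A : Matrix (Fin d) (Fin d) ℝ) (a : Fin m → Fin d → ℝ) : Fin m → Fin d → ℝ :=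
  fun i => ∑ j ∈ Finset.Iic i, (a j ⬝ᵥ (A *ᵥ a i)) • a j

theorem contDiff_baseRet (A : Matrix (Fin d) (Fin d) ℝ) :
    ContDiff ℝ ω (baseRet A : (Fin m → Fin d → ℝ) → _) := by
  rw [contDiff_pi]
  intro i
  rw [contDiff_pi]
  intro k
  simp only [baseRet, Finset.sum_apply, Pi.smul_apply, smul_eq_mul, dotProduct, Matrix.mulVec]
  fun_prop

/-- Causality: earlier outputs do not see the new token. -/
theorem baseRet_snoc (A : Matrix (Fin d) (Fin d) ℝ) (a : Fin m → Fin d → ℝ) (x : Fin d → ℝ) :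
    baseRet A (Fin.snoc a x : Fin (m + 1) → Fin d → ℝ) =
      Fin.snoc (baseRet A a) (tokenMap (prefixMatrix A a) A x) := by
  have hIic {n : ℕ} (i : Fin n) (f : Fin n → Fin d → ℝ) :
      ∑ j ∈ Finset.Iic i, f j = ∑ j, if j ≤ i then f j else 0 := by
    rw [← Finset.sum_filter]
    congr 1
    ext
    simp
  funext i
  induction i using Fin.lastCases with
  | last =>
    simp only [baseRet, hIic, Fin.sum_univ_castSucc, Fin.snoc_last, Fin.snoc_castSucc, Fin.le_last,
      if_true, tokenMap, prefixMatrix_mulVec]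
    congr 1
    funext k
    simp [Matrix.mulVec, dotProduct, mul_comm]
  | cast i =>
    simp only [baseRet, hIic, Fin.sum_univ_castSucc, Fin.snoc_last, Fin.snoc_castSucc,
      Fin.castSucc_le_castSucc_iff, (Fin.castSucc_lt_last i).not_ge, if_false, add_zero]

theorem GenericForm.almostSurjective_baseRet {A : Matrix (Fin d) (Fin d) ℝ}
    (hA : GenericForm A) (n : ℕ) :
    AlmostSurjective (baseRet A : (Fin n → Fin d → ℝ) → Fin n → Fin d → ℝ) := by
  induction n with
  | zero => exact Eventually.of_forall fun y => ⟨y, Subsingleton.elim _ _⟩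
  | succ n ih =>
    have hc := (contDiff_baseRet (m := n) A).differentiable (by simp)
    have hae : ∀ᵐ c : Fin n → Fin d → ℝ, ∀ᵐ y : Fin d → ℝ,
        (Fin.snoc c y : Fin (n + 1) → Fin d → ℝ) ∈ range (baseRet A) := by
      -- The preimage `a` of a generic `c` can itself be chosen generic, so that the equation for
      -- the next token is solvable for almost every `y`.
      filter_upwards [ih.ae_exists_and hc (hA.ae_almostSurjective n)] with c hcs
      obtain ⟨a, rfl, ha⟩ := hcs
      filter_upwards [ha] with y hy
      obtain ⟨x, rfl⟩ := hy
      exact ⟨Fin.snoc a x, baseRet_snoc A a x⟩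
    have hmr : MeasurableSet (range (baseRet A : (Fin (n + 1) → Fin d → ℝ) → _)) := by
      obtain ⟨K, hK, hKu⟩ := isSigmaCompact_range (contDiff_baseRet (m := n + 1) A).continuous
      rw [← hKu]
      exact MeasurableSet.iUnion fun n => (hK n).isClosed.measurableSet
    let e := MeasurableEquiv.piFinSuccAbove (fun _ : Fin (n + 1) => Fin d → ℝ) (Fin.last n)
    have he : MeasurePreserving e :=
      volume_preserving_piFinSuccAbove (fun _ : Fin (n + 1) => Fin d → ℝ) (Fin.last n)
    have hes (y : Fin d → ℝ) (c : Fin n → Fin d → ℝ) : e.symm (y, c) = Fin.snoc c y := by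
      rw [MeasurableEquiv.symm_apply_eq]
      ext <;> simp [e, MeasurableEquiv.piFinSuccAbove]
    have hpre : MeasurableSet (e.symm ⁻¹' range (baseRet A)) := e.symm.measurable hmr
    have hprod : ∀ᵐ p ∂(volume : Measure (Fin d → ℝ)).prod
        (volume : Measure (Fin n → Fin d → ℝ)), e.symm p ∈ range (baseRet A) := by
      rw [Measure.ae_prod_iff_ae_ae hpre, Measure.ae_ae_comm (p := fun y c => e.symm (y, c) ∈ range (baseRet A)) hpre]
      simpa only [hes] using hae
    have := he.quasiMeasurePreserving.ae hprod
    filter_upwards [this] with y hy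
    simpa using hy

theorem ae_genericForm :
    ∀ᵐ θ : Entries d × Entries d × Entries d,
      GenericForm ((Matrix.of θ.1)ᵀ * Matrix.of θ.2.1) ∧ (Matrix.of θ.2.2).det ≠ 0 := by
  have h₂ : (volume : Measure (Entries d × Entries d)).IsAddHaarMeasure :=
    Measure.prod.instIsAddHaarMeasure _ _
  have h₃ : (volume : Measure (Entries d × Entries d × Entries d)).IsAddHaarMeasure :=
    Measure.prod.instIsAddHaarMeasure _ _
  -- At `K = Q = V = 1` the Gram matrix of standard basis vectors is the identity.
  let x₀ : Entries d × Entries d × Entries d :=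
    ((1 : Matrix (Fin d) (Fin d) ℝ), (1 : Matrix (Fin d) (Fin d) ℝ), (1 : Matrix (Fin d) (Fin d) ℝ))
  have hV := ae_ne_zero_of_contDiff_omega
    (volume : Measure (Entries d × Entries d × Entries d))
    (q := fun θ => (Matrix.of θ.2.2).det) (x₀ := x₀)
    (contDiff_det fun i j => by simp only [Matrix.of_apply]; fun_prop)
    (by change (1 : Matrix (Fin d) (Fin d) ℝ).det ≠ 0; simp)
  have hG : ∀ᵐ θ : Entries d × Entries d × Entries d,
      GenericForm ((Matrix.of θ.1)ᵀ * Matrix.of θ.2.1) := by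
    unfold GenericForm
    rw [ae_all_iff]
    intro m
    rw [eventually_imp_distrib_left]
    intro hm
    let a : Fin m → Fin d → ℝ := fun i => Pi.single (Fin.castLE hm i) 1
    have hae := ae_ne_zero_of_contDiff_omega
      (volume : Measure (Entries d × Entries d × Entries d))
      (q := fun θ => (formGram ((Matrix.of θ.1)ᵀ * Matrix.of θ.2.1) a).det) (x₀ := x₀)
      (contDiff_det_formGram (fun i j => by
        simp only [Matrix.mul_apply, Matrix.transpose_apply, Matrix.of_apply]
        fun_prop) (fun _ _ => contDiff_const)) ?_
    · filter_upwards [hae] with θ hθ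
      exact ⟨a, hθ⟩
    · change (formGram ((1 : Matrix (Fin d) (Fin d) ℝ)ᵀ * 1) a).det ≠ 0
      have : formGram ((1 : Matrix (Fin d) (Fin d) ℝ)ᵀ * 1) a = 1 := by
        ext i j
        simp [formGram, a, Matrix.mul_apply, Matrix.one_apply, Pi.single_apply, eq_comm]
      rw [this, Matrix.det_one]
      exact one_ne_zero
  exact hG.and hV

/-- An invertible `V` acts tokenwise as a linear bijection, which preserves null sets. -/
theorem almostAlwaysSurjective_ret (n d : ℕ) :
    AlmostAlwaysSurjective (volume : Measure (Entries d × Entries d × Entries d))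
      (fun θ (a : Fin n → Fin d → ℝ) =>
        ret (Matrix.of θ.1) (Matrix.of θ.2.1) (Matrix.of θ.2.2) a) := by
  filter_upwards [ae_genericForm] with θ hθ
  obtain ⟨hA, hV⟩ := hθ
  set A := (Matrix.of θ.1)ᵀ * Matrix.of θ.2.1
  set V := Matrix.of θ.2.2
  have hret (a : Fin n → Fin d → ℝ) :
      ret (Matrix.of θ.1) (Matrix.of θ.2.1) V a = fun i => V *ᵥ baseRet A a i := by
    funext i
    simp only [ret, baseRet, Matrix.mulVec_sum, Matrix.mulVec_smul, A]
  have hnull := hA.almostSurjective_baseRet n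
  rw [AlmostSurjective, ae_iff] at hnull ⊢
  have hd : Differentiable ℝ fun (c : Fin n → Fin d → ℝ) i => V *ᵥ c i := by
    rw [differentiable_pi]
    intro i
    rw [differentiable_pi]
    intro k
    simp only [Matrix.mulVec, dotProduct]
    fun_prop
  refine measure_mono_null (fun b hb => ?_)
    (addHaar_image_eq_zero_of_differentiableOn_of_addHaar_eq_zero volume
      hd.differentiableOn hnull)
  have hVV (x : Fin d → ℝ) : V *ᵥ (V⁻¹ *ᵥ x) = x := by
    rw [Matrix.mulVec_mulVec, Matrix.mul_nonsing_inv _ (isUnit_iff_ne_zero.2 hV),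
      Matrix.one_mulVec]
  refine ⟨fun i => V⁻¹ *ᵥ b i, ?_, funext fun i => hVV _⟩
  rintro ⟨a, ha⟩
  refine hb ⟨a, ?_⟩
  rw [hret, ha]
  exact funext fun i => hVV _

end Layer

end Retention

theorem theorem3p5 :
    (∀ n d : ℕ,
      Retention.AlmostAlwaysSurjective
        (volume : Measure (Retention.Entries d × Retention.Entries d × Retention.Entries d))
        (fun θ (a : Fin n → Fin d → ℝ) =>
          Retention.ret (Matrix.of θ.1) (Matrix.of θ.2.1) (Matrix.of θ.2.2) a)) ∧
    (∀ d rM rN : ℕ, 1 ≤ rM → rM ≤ d → 1 ≤ rN → rN ≤ d →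
      Retention.AlmostAlwaysSurjective
        (Retention.fixedRankMeasure d rM rN)
        (fun θ (x : Fin d → ℝ) =>
          Retention.tokenMap (Matrix.of θ.1.1) (Matrix.of θ.1.2) x)) := by
  exact ⟨Retention.almostAlwaysSurjective_ret,
    fun _ _ _ _ hM hN hN' => Retention.almostAlwaysSurjective_tokenMap hM hN hN'⟩
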